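/- Let $\mathbb{k}$ be an algebraically closed field, let $\Lambda$ be a finite-dimensional $\mathbb{k}$-algebra, and let $\operatorname{proj}\Lambda$ be the category of finitely generated projective right $\Lambda$-modules. Write $C^b(\operatorname{proj}\Lambda)$ and $K^b(\operatorname{proj}\Lambda)$ for the category of bounded (cochain) complexes over $\operatorname{proj}\Lambda$ and its homotopy category, and for $n\ge 2$ let $C_n(\operatorname{proj}\Lambda)$ be the full subcategory of the complexes $X$ with $X^j=0$ for all $j\notin\{1,\dots,n\}$. Consider $C^b(\operatorname{proj}\Lambda)$ with the exact structure given by the degreewise split short exact sequences. A nonzero object $X$ of $K^b(\operatorname{proj}\Lambda)$ is isomorphic to the image of a complex $\bar X\in C^b(\operatorname{proj}\Lambda)$ that has no indecomposable projective direct summands (projective with respect to this exact structure), and $\bar X$ is unique up to isomorphism; the length of $X$ is $\ell(X)=s-r$, where $r\le s$ are such that $\bar X^r\neq 0\neq\bar X^s$ and $\bar X^j=0$ for $j<r$ and for $j>s$. The strong global dimension of $\Lambda$ is $$\operatorname{s.gl.dim}(\Lambda)=\sup\{\ell(X)\mid X\in K^b(\operatorname{proj}\Lambda)\text{ indecomposable}\}\in\mathbb{N}\cup\{\infty\}.$$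 Suppose that $\eta=\operatorname{s.gl.dim}(\Lambda)$ is finite and $\eta\ge 1$. Then for every integer $i\ge 2$, every indecomposable object $X$ of $C_{\eta+i}(\operatorname{proj}\Lambda)$ satisfies $X^1=0$ or $X^{\eta+i}=0$. -/

import Mathlib

open CategoryTheory CategoryTheory.Limits

universe u v w

namespace FixedSizeComplexes

section Categories

variable {A : Type u} [Category.{v} A] [Preadditive A]

/-- A full subcategory of a preadditive category that contains, for any two of its objects, the
vertex of a biproduct diagram on them has binary biproducts. -/
theorem hasBinaryBiproducts_fullSubcategory (P : ObjectProperty A)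
    (h : ∀ X Y : A, P X → P Y → ∃ b : BinaryBicone X Y,
      P b.pt ∧ b.fst ≫ b.inl + b.snd ≫ b.inr = 𝟙 b.pt) :
    HasBinaryBiproducts P.FullSubcategory where
  has_binary_biproduct X Y := by
    obtain ⟨b, hb, ht⟩ := h X.obj Y.obj X.property Y.property
    let c : BinaryBicone X Y :=
      { pt := ⟨b.pt, hb⟩
        fst := ObjectProperty.homMk b.fst
        snd := ObjectProperty.homMk b.snd
        inl := ObjectProperty.homMk b.inl
        inr := ObjectProperty.homMk b.inr
        inl_fst := by ext; exact b.inl_fst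
        inl_snd := by ext; exact b.inl_snd
        inr_fst := by ext; exact b.inr_fst
        inr_snd := by ext; exact b.inr_snd }
    exact hasBinaryBiproduct_of_total c (by ext; exact ht)

variable (A)

/-- The complexes `K` over `A` with `K^i = 0` for `i ∉ {1, …, n}`. -/
def fixedSize (n : ℕ) : ObjectProperty (CochainComplex A ℤ) :=
  fun K => ∀ i : ℤ, (i < 1 ∨ (n : ℤ) < i) → IsZero (K.X i)

/-- `C_n(A)`: the full subcategory of complexes over `A` concentrated in degrees `1, …, n`. -/
abbrev FixedSize (n : ℕ) := (fixedSize A n).FullSubcategory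

/-- The bounded complexes over `A`. -/
def bounded : ObjectProperty (CochainComplex A ℤ) :=
  fun K => ∃ r s : ℤ, ∀ i : ℤ, (i < r ∨ s < i) → IsZero (K.X i)

/-- `C^b(A)`: the category of bounded complexes over `A`. -/
abbrev BoundedComplex := (bounded A).FullSubcategory

/-- The objects of the homotopy category of complexes given by bounded complexes. -/
def homotopyBounded : ObjectProperty (HomotopyCategory A (ComplexShape.up ℤ)) :=
  fun X => bounded A X.as

/-- `K^b(A)`: the homotopy category of bounded complexes over `A`. -/
abbrev BoundedHomotopy := (homotopyBounded A).FullSubcategory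

variable {A}

/-- The object of `K^b(A)` given by a bounded complex. -/
def toHomotopy (K : BoundedComplex A) : BoundedHomotopy A :=
  ⟨(HomotopyCategory.quotient A (ComplexShape.up ℤ)).obj K.obj, K.property⟩

section Biproducts

variable [HasBinaryBiproducts A]

theorem isZero_biprod_X {K L : CochainComplex A ℤ} {i : ℤ} (hK : IsZero (K.X i))
    (hL : IsZero (L.X i)) : IsZero ((K ⊞ L).X i) :=
  IsZero.of_iso ((biprod_isZero_iff _ _).2 ⟨hK, hL⟩) (HomologicalComplex.biprodXIso K L i)

theorem bounded_biprod {K L : CochainComplex A ℤ} (hK : bounded A K) (hL : bounded A L) :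
    bounded A (K ⊞ L) := by
  obtain ⟨r, s, h⟩ := hK
  obtain ⟨r', s', h'⟩ := hL
  refine ⟨min r r', max s s', fun i hi => isZero_biprod_X (h i ?_) (h' i ?_)⟩ <;> omega

instance (n : ℕ) : HasBinaryBiproducts (FixedSize A n) :=
  hasBinaryBiproducts_fullSubcategory _ fun X Y hX hY =>
    ⟨BinaryBiproduct.bicone X Y, fun i hi => isZero_biprod_X (hX i hi) (hY i hi), biprod.total⟩

instance : HasBinaryBiproducts (BoundedComplex A) :=
  hasBinaryBiproducts_fullSubcategory _ fun X Y hX hY =>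
    ⟨BinaryBiproduct.bicone X Y, bounded_biprod hX hY, biprod.total⟩

instance : HasBinaryBiproducts (BoundedHomotopy A) :=
  hasBinaryBiproducts_fullSubcategory _ fun X Y hX hY => by
    obtain ⟨K, rfl⟩ := HomotopyCategory.quotient_obj_surjective X
    obtain ⟨L, rfl⟩ := HomotopyCategory.quotient_obj_surjective Y
    refine ⟨(HomotopyCategory.quotient A (ComplexShape.up ℤ)).mapBinaryBicone
      (BinaryBiproduct.bicone K L), bounded_biprod hX hY, ?_⟩
    have h := congrArg (HomotopyCategory.quotient A (ComplexShape.up ℤ)).map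
      (biprod.total (X := K) (Y := L))
    rw [Functor.map_add, Functor.map_comp, Functor.map_comp, CategoryTheory.Functor.map_id] at h
    exact h

end Biproducts

/-- Deflations of the exact structure on `C^b(A)`: the second maps `f` of the pairs of composable
morphisms `W ⟶ Y ⟶ Z` such that `0 ⟶ W^n ⟶ Y^n ⟶ Z^n ⟶ 0` is split exact for all `n`. -/
def IsDeflation {Y Z : BoundedComplex A} (f : Y ⟶ Z) : Prop :=
  ∃ (W : BoundedComplex A) (i : W ⟶ Y), ∀ n : ℤ,
    ∃ h : i.hom.f n ≫ f.hom.f n = 0,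
      Nonempty (ShortComplex.mk (i.hom.f n) (f.hom.f n) h).Splitting

/-- Projective objects of the exact category `C^b(A)`. -/
def IsExactProjective (P : BoundedComplex A) : Prop :=
  ∀ ⦃Y Z : BoundedComplex A⦄ (f : Y ⟶ Z), IsDeflation f → ∀ u : P ⟶ Z, ∃ g : P ⟶ Y, g ≫ f = u

/-- A bounded complex without indecomposable projective direct summands. -/
def IsMinimal [HasBinaryBiproducts A] (K : BoundedComplex A) : Prop :=
  ¬ ∃ P Q : BoundedComplex A,
    Nonempty (K ≅ P ⊞ Q) ∧ Indecomposable P ∧ IsExactProjective P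

/-- `HasLength X l` says that the object `X` of `K^b(A)` has length `l`: it has a preimage `K`
in `C^b(A)` without indecomposable projective direct summands, with `K^r ≠ 0 ≠ K^s`,
`K^i = 0` for `i < r` and for `i > s`, and `l = s - r`. -/
def HasLength [HasBinaryBiproducts A] (X : BoundedHomotopy A) (l : ℕ) : Prop :=
  ∃ K : BoundedComplex A, IsMinimal K ∧ Nonempty (toHomotopy K ≅ X) ∧
    ∃ r s : ℤ, r ≤ s ∧ ¬ IsZero (K.obj.X r) ∧ ¬ IsZero (K.obj.X s) ∧
      (∀ i : ℤ, (i < r ∨ s < i) → IsZero (K.obj.X i)) ∧ (l : ℤ) = s - r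

end Categories

section Algebras

variable (Λ : Type w) [Ring Λ]

/-- The finitely generated projective right `Λ`-modules; a right `Λ`-module is a module over the
opposite ring. -/
def fgProjective : ObjectProperty (ModuleCat.{w} Λᵐᵒᵖ) :=
  fun M => Module.Finite Λᵐᵒᵖ M ∧ Module.Projective Λᵐᵒᵖ M

/-- `proj Λ`: the category of finitely generated projective right `Λ`-modules. -/
abbrev ProjCat := (fgProjective Λ).FullSubcategory

instance : HasBinaryBiproducts (ProjCat Λ) :=
  hasBinaryBiproducts_fullSubcategory _ fun X Y hX hY => by
    have := hX.1
    have := hX.2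
    have := hY.1
    have := hY.2
    exact ⟨BinaryBiproduct.bicone X Y,
      ⟨Module.Finite.equiv (ModuleCat.biprodIsoProd X Y).toLinearEquiv.symm,
        Module.Projective.of_equiv (ModuleCat.biprodIsoProd X Y).toLinearEquiv.symm⟩,
      biprod.total⟩

/-- The strong global dimension of `Λ`: the supremum in `ℕ ∪ {∞}` of the lengths of the
indecomposable objects of `K^b(proj Λ)`. -/
noncomputable def strongGlobalDimension : ℕ∞ :=
  sSup {d : ℕ∞ | ∃ (X : BoundedHomotopy (ProjCat Λ)) (l : ℕ),
    Indecomposable X ∧ HasLength X l ∧ d = (l : ℕ∞)}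

end Algebras

end FixedSizeComplexes

/-!
Let `X` be indecomposable in `C_n(proj Λ)` with `n = η + i ≥ 3`, and suppose that both `X^1` and
`X^n` are nonzero. The argument shows that `X` is an indecomposable object of `K^b(proj Λ)` of
length `n - 1 > η`.

* Idempotents split in `C_n(proj Λ)`, so `X` has only the idempotents `0` and `𝟙`
  (`eq_zero_or_eq_id_of_indecomposable`).
* `X` is not contractible: otherwise the complex `X^1 = X^1` in degrees `1` and `2` would be a
  direct summand, and the corresponding idempotent is neither `0` (as `X^1 ≠ 0`) nor `𝟙`
  (as `X^n ≠ 0` and `n ≥ 3`); see `isZero_X_of_homotopy_id_zero`.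
* Projective objects of the exact category `C^b(proj Λ)` are contractible
  (`IsExactProjective.homotopy_id_zero`). Hence `X` is not projective, and being indecomposable it
  has no indecomposable projective summand (`isMinimal_of_idempotents`).
* The algebra of endomorphisms of `X` in `C^b(proj Λ)` is finite-dimensional without nontrivial
  idempotents, so each of its elements is nilpotent or invertible (`isNilpotent_or_isUnit`). This
  passes to the quotient by null-homotopic maps, so `X` stays indecomposable in `K^b(proj Λ)`
  (`indecomposable_toHomotopy`).
-/

namespace FixedSizeComplexes

/-! ### Indecomposable objects and idempotents -/

section Idempotents

variable {C : Type u} [Category.{v} C]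

theorem isIdempotentComplete_fullSubcategory [IsIdempotentComplete C] (P : ObjectProperty C)
    [P.IsStableUnderRetracts] : IsIdempotentComplete P.FullSubcategory where
  idempotents_split X e he := by
    obtain ⟨Y, i, p, hip, hpi⟩ := IsIdempotentComplete.idempotents_split X.obj e.hom
      (congrArg (·.hom) he)
    have hY : P Y := P.prop_of_retract ⟨i, p, hip⟩ X.property
    exact ⟨⟨Y, hY⟩, ObjectProperty.homMk i, ObjectProperty.homMk p, by ext; exact hip,
      by ext; exact hpi⟩

variable [Preadditive C]

theorem eq_zero_or_eq_id_of_indecomposable [HasBinaryBiproducts C] [IsIdempotentComplete C]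
    {X : C} (hX : Indecomposable X) (e : X ⟶ X) (he : e ≫ e = e) : e = 0 ∨ e = 𝟙 X := by
  obtain ⟨Y, i, p, hip, hpi⟩ := IsIdempotentComplete.idempotents_split X e he
  obtain ⟨Z, j, q, hjq, hqj⟩ := IsIdempotentComplete.idempotents_split X (𝟙 X - e)
    (Idempotents.idem_of_id_sub_idem e he)
  have hie : i ≫ e = i := by rw [← hpi, ← Category.assoc, hip, Category.id_comp]
  have hje : j ≫ e = 0 := by
    have : j ≫ (𝟙 X - e) = j := by rw [← hqj, ← Category.assoc, hjq, Category.id_comp]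
    simpa using this
  have hep : e ≫ p = p := by rw [← hpi, Category.assoc, hip, Category.comp_id]
  have heq : e ≫ q = 0 := by
    have : (𝟙 X - e) ≫ q = q := by rw [← hqj, Category.assoc, hjq, Category.comp_id]
    simpa using this
  have hiq : i ≫ q = 0 := by rw [← hie, Category.assoc, heq, comp_zero]
  have hjp : j ≫ p = 0 := by rw [← hep, ← Category.assoc, hje, zero_comp]
  let φ : X ≅ Y ⊞ Z :=
    { hom := biprod.lift p q
      inv := biprod.desc i j
      hom_inv_id := by rw [biprod.lift_desc, hpi, hqj]; abel
      inv_hom_id := by ext <;> simp [hip, hiq, hjp, hjq] }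
  rcases hX.2 Y Z φ with h | h
  · left
    rw [← hpi, h.eq_of_tgt p 0, zero_comp]
  · right
    rw [h.eq_of_tgt q 0, zero_comp] at hqj
    exact (sub_eq_zero.1 hqj.symm).symm

theorem isZero_or_isZero_of_iso_biprod [HasBinaryBiproducts C] {X Y Z : C}
    (h : ∀ e : X ⟶ X, e ≫ e = e → e = 0 ∨ e = 𝟙 X) (φ : X ≅ Y ⊞ Z) :
    IsZero Y ∨ IsZero Z := by
  rcases h (φ.hom ≫ biprod.fst ≫ biprod.inl ≫ φ.inv) (by simp) with h | h
  · left
    rw [IsZero.iff_id_eq_zero]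
    have := congrArg (fun t => biprod.inl ≫ φ.inv ≫ t ≫ φ.hom ≫ biprod.fst) h
    simpa using this
  · right
    rw [IsZero.iff_id_eq_zero]
    have := congrArg (fun t => biprod.inr ≫ φ.inv ≫ t ≫ φ.hom ≫ biprod.snd) h
    simpa using this.symm

/-- In contrast to `eq_zero_or_eq_id_of_indecomposable`, no idempotent has to split, so that the
criterion applies to homotopy categories. -/
theorem indecomposable_of_idempotents [HasBinaryBiproducts C] {X : C} (hX : ¬ IsZero X)
    (h : ∀ e : X ⟶ X, e ≫ e = e → e = 0 ∨ e = 𝟙 X) : Indecomposable X :=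
  ⟨hX, fun _ _ φ => isZero_or_isZero_of_iso_biprod h φ⟩

end Idempotents

/-! ### Finite-dimensional algebras without nontrivial idempotents -/

section Fitting

open Polynomial in
/-- If `f` is a root of `X ^ (m + 1) * q` with `X` and `q` coprime, a Bézout relation
`a * X ^ (m + 1) + b * q = 1` yields an idempotent `a(f) * f ^ (m + 1)`; it is `0` only if `f` is
nilpotent, and `1` only if `f` is invertible. -/
theorem isNilpotent_or_isUnit {k R : Type*} [Field k] [Ring R] [Algebra k R] [Module.Finite k R]
    (h : ∀ e : R, e * e = e → e = 0 ∨ e = 1) (f : R) : IsNilpotent f ∨ IsUnit f := by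
  obtain ⟨q, hq, hqX⟩ := exists_eq_pow_rootMultiplicity_mul_and_not_dvd (minpoly k f)
    (minpoly.ne_zero (Algebra.IsIntegral.isIntegral f)) 0
  rw [C_0, sub_zero] at hq hqX
  generalize rootMultiplicity 0 (minpoly k f) = m at hq
  have hf : aeval f (X ^ m * q) = 0 := by rw [← hq, minpoly.aeval]
  -- The exponent is `m + 1`, not `m`: for invertible `f` one has `m = 0`, and the idempotent must
  -- still have `f` as a factor.
  obtain ⟨a, b, hab⟩ : IsCoprime (X ^ (m + 1)) q :=
    ((irreducible_X.coprime_iff_not_dvd).2 hqX).pow_left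
  have hf' : ∀ r : k[X], aeval f (r * (X ^ (m + 1) * q)) = 0 := fun r => by
    rw [show r * (X ^ (m + 1) * q) = r * X * (X ^ m * q) by ring, map_mul, hf, mul_zero]
  rcases h (aeval f (a * X ^ (m + 1))) (by
    rw [← map_mul, eq_comm, ← sub_eq_zero, ← map_sub, ← hf' (a * b)]
    congr 1
    linear_combination -(a * X ^ (m + 1)) * hab) with he | he
  · left
    refine ⟨m + 1, ?_⟩
    have h1 : aeval f (X ^ (m + 1) : k[X]) =
        aeval f (X ^ (m + 1) : k[X]) * aeval f (a * X ^ (m + 1)) +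
          aeval f (b * (X ^ (m + 1) * q)) := by
      rw [← map_mul, ← map_add]
      congr 1
      linear_combination -(X ^ (m + 1)) * hab
    rwa [he, hf', mul_zero, add_zero, map_pow, aeval_X] at h1
  · right
    have h1 : aeval f (X * (a * X ^ m) : k[X]) = 1 := by
      rw [← he]
      congr 1
      ring
    have h2 : aeval f (a * X ^ m * X : k[X]) = 1 := by
      rw [mul_comm, h1]
    rw [map_mul, aeval_X] at h1 h2
    exact isUnit_iff_exists.2 ⟨_, h1, h2⟩

theorem eq_zero_or_one_of_isNilpotent_or_isUnit {R S : Type*} [MonoidWithZero R]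
    [MonoidWithZero S] (φ : R →* S) (hφ : φ 0 = 0) {f : R} (h : IsNilpotent f ∨ IsUnit f)
    (he : φ f * φ f = φ f) : φ f = 0 ∨ φ f = 1 := by
  rcases h with ⟨n, hn⟩ | h
  · left
    rw [← IsIdempotentElem.pow_succ_eq n he, pow_succ, ← map_pow, hn, hφ, zero_mul]
  · right
    exact (h.map φ).mul_eq_left.1 he

end Fitting

/-! ### Contractible complexes and exact projectives -/

section Complexes

variable {A : Type u} [Category.{v} A] [Preadditive A]

instance (n : ℕ) : (fixedSize A n).IsStableUnderRetracts where
  of_retract r hY i hi := by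
    rw [IsZero.iff_id_eq_zero]
    have := congrArg (fun t => HomologicalComplex.Hom.f t i) r.retract
    rw [← HomologicalComplex.id_f, ← this]
    dsimp
    rw [(hY i hi).eq_of_tgt (r.i.f i) 0, zero_comp]

theorem fixedSize_le_bounded (n : ℕ) : fixedSize A n ≤ bounded A :=
  fun _ hK => ⟨1, n, hK⟩

/-- A contractible complex whose lowest nonzero term is `K^a` has the direct summand
`K^a = K^a` in degrees `a` and `a + 1`. So, if it has no nontrivial idempotents, it vanishes in
degrees at least `a + 2`. -/
theorem isZero_X_of_homotopy_id_zero {K : CochainComplex A ℤ} (h : Homotopy (𝟙 K) 0)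
    (hK : ∀ e : K ⟶ K, e ≫ e = e → e = 0 ∨ e = 𝟙 K) {a : ℤ}
    (hlt : ∀ i < a, IsZero (K.X i)) (ha : ¬ IsZero (K.X a)) {j : ℤ} (hj : a + 2 ≤ j) :
    IsZero (K.X j) := by
  -- Of the contracting homotopy only the component `K^(a + 1) ⟶ K^a` is kept: the resulting
  -- null-homotopic map is the idempotent projecting onto the summand `K^a = K^a`.
  let s : ∀ p q : ℤ, K.X p ⟶ K.X q := fun p q => if p = a + 1 then h.hom p q else 0
  let e : K ⟶ K := Homotopy.nullHomotopicMap s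
  have hs : ∀ p q : ℤ, p ≠ a + 1 → s p q = 0 := fun p q hp => if_neg hp
  have hs1 : s (a + 1) a = h.hom (a + 1) a := if_pos rfl
  have hef (p q r : ℤ) (hpq : p + 1 = q) (hqr : q + 1 = r) :
      e.f q = K.d q r ≫ s r q + s q p ≫ K.d p q :=
    Homotopy.nullHomotopicMap_f (c := ComplexShape.up ℤ) hpq hqr s
  have hda : K.d a (a + 1) ≫ h.hom (a + 1) a = 𝟙 (K.X a) := by
    have := h.comm a
    rw [dNext_eq h.hom (show (ComplexShape.up ℤ).Rel a (a + 1) from rfl),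
      prevD_eq h.hom (show (ComplexShape.up ℤ).Rel (a - 1) a from sub_add_cancel a 1),
      (hlt (a - 1) (by lia)).eq_of_tgt (h.hom a (a - 1)) 0] at this
    simpa using this.symm
  have hea : e.f a = 𝟙 (K.X a) := by
    rw [hef (a - 1) a (a + 1) (by lia) rfl, hs a _ (by lia), zero_comp, add_zero, hs1, hda]
  have hea1 : e.f (a + 1) = h.hom (a + 1) a ≫ K.d a (a + 1) := by
    rw [hef a (a + 1) (a + 1 + 1) rfl rfl, hs (a + 1 + 1) _ (by lia), comp_zero, zero_add, hs1]
  have he0 (q : ℤ) (hq : q ≠ a) (hq' : q ≠ a + 1) : e.f q = 0 := by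
    rw [hef (q - 1) q (q + 1) (by lia) rfl, hs _ _ hq', hs _ _ (by lia), comp_zero, zero_comp,
      add_zero]
  have he : e ≫ e = e := by
    ext q
    rw [HomologicalComplex.comp_f]
    by_cases hq : q = a
    · subst hq
      rw [hea, Category.comp_id]
    · by_cases hq' : q = a + 1
      · subst hq'
        rw [hea1, Category.assoc, reassoc_of% hda]
      · rw [he0 q hq hq', comp_zero]
  rcases hK e he with h0 | h1
  · refine absurd ?_ ha
    rw [IsZero.iff_id_eq_zero, ← hea, h0, HomologicalComplex.zero_f]
  · rw [IsZero.iff_id_eq_zero, ← HomologicalComplex.id_f, ← h1, he0 j (by lia) (by lia)]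

section Projective

theorem bounded_shift {K : CochainComplex A ℤ} (hK : bounded A K) (n : ℤ) :
    bounded A (K⟦n⟧) := by
  obtain ⟨r, s, h⟩ := hK
  exact ⟨r - n, s - n, fun i hi => h (i + n) (by lia)⟩

variable [HasBinaryBiproducts A]

theorem bounded_mappingCone {K L : CochainComplex A ℤ} (φ : K ⟶ L) (hK : bounded A K)
    (hL : bounded A L) : bounded A (CochainComplex.mappingCone φ) := by
  obtain ⟨r, s, h⟩ := hK
  obtain ⟨r', s', h'⟩ := hL
  refine ⟨min (r - 1) r', max s s', fun i hi => ?_⟩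
  exact ((biprod_isZero_iff _ _).2 ⟨h (i + 1) (by lia), h' i (by lia)⟩).of_iso
    (HomologicalComplex.homotopyCofiber.XIsoBiprod φ i (i + 1) rfl)

/-- Exact projectives are contractible: with `K = P⟦-1⟧`, the degreewise split epimorphism from the
cone of `𝟙 K` to `K⟦1⟧ ≅ P` has a section, and this cone is contractible. -/
theorem IsExactProjective.homotopy_id_zero {P : BoundedComplex A} (hP : IsExactProjective P) :
    Nonempty (Homotopy (𝟙 P.obj) 0) := by
  let K : CochainComplex A ℤ := P.obj⟦(-1 : ℤ)⟧
  have hK : bounded A K := bounded_shift P.property _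
  let M := CochainComplex.mappingCone (𝟙 K)
  let S := CochainComplex.mappingCone.triangleRotateShortComplex (𝟙 K)
  let Y : BoundedComplex A := ⟨M, bounded_mappingCone _ hK hK⟩
  let Z : BoundedComplex A := ⟨K⟦(1 : ℤ)⟧, bounded_shift hK _⟩
  let W : BoundedComplex A := ⟨K, hK⟩
  let δ : M ⟶ K⟦(1 : ℤ)⟧ := S.g
  let i : W ⟶ Y := ObjectProperty.homMk S.f
  let f : Y ⟶ Z := ObjectProperty.homMk δ
  have hf : IsDeflation f := ⟨W, i, fun n => ⟨congrArg (fun t => t.f n) S.zero,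
    ⟨CochainComplex.mappingCone.triangleRotateShortComplexSplitting (𝟙 K) n⟩⟩⟩
  let α : P.obj ≅ K⟦(1 : ℤ)⟧ := (shiftNegShift P.obj (1 : ℤ)).symm
  obtain ⟨g, hg⟩ := hP f hf (ObjectProperty.homMk α.hom)
  have hg' : g.hom ≫ 𝟙 M ≫ δ = α.hom := by
    rw [Category.id_comp]
    exact congrArg (·.hom) hg
  have H := ((((CochainComplex.mappingCone.homotopyToZeroOfId K).compRight δ).compLeft
    g.hom).compRight α.inv)
  refine ⟨(Homotopy.ofEq ?_).trans (H.trans (Homotopy.ofEq ?_))⟩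
  · rw [hg', α.hom_inv_id]
  · rw [zero_comp, comp_zero, zero_comp]

end Projective

end Complexes

/-! ### From `C^b(A)` to `K^b(A)` -/

section Bounded

variable {A : Type u} [Category.{v} A] [Preadditive A]

theorem isMinimal_of_idempotents [HasBinaryBiproducts A] {K : BoundedComplex A}
    (hK : ∀ e : K.obj ⟶ K.obj, e ≫ e = e → e = 0 ∨ e = 𝟙 K.obj)
    (hK' : IsEmpty (Homotopy (𝟙 K.obj) 0)) : IsMinimal K := by
  rintro ⟨P, Q, ⟨φ⟩, hP, hP'⟩
  -- `P` is nonzero, so `Q = 0` and `K ≅ P` is contractible.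
  have hQ : IsZero Q := (isZero_or_isZero_of_iso_biprod (fun (e : K ⟶ K) he =>
    (hK e.hom (congrArg (fun t : K ⟶ K => t.hom) he)).imp (fun h => by ext1; exact h)
      (fun h => by ext1; exact h)) φ).resolve_left hP.1
  obtain ⟨h⟩ := hP'.homotopy_id_zero
  have hPK : (φ.hom ≫ biprod.fst) ≫ biprod.inl ≫ φ.inv = 𝟙 K := by
    have h1 := congrArg (fun t => φ.hom ≫ t ≫ φ.inv) (biprod.total (X := P) (Y := Q))
    rw [hQ.eq_of_tgt (biprod.snd : P ⊞ Q ⟶ Q) 0] at h1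
    simpa using h1
  refine hK'.false ((Homotopy.ofEq ?_).trans
    (((h.compLeft (φ.hom ≫ biprod.fst).hom).compRight (biprod.inl ≫ φ.inv).hom).trans
      (Homotopy.ofEq ?_)))
  · rw [Category.comp_id]
    exact (congrArg (·.hom) hPK).symm
  · rw [comp_zero, zero_comp]

/-- Passing to the homotopy category keeps indecomposability when every endomorphism is nilpotent or
invertible: a lift of an idempotent of `K^b(A)` is one or the other, so the idempotent is `0` or
the identity. -/
theorem indecomposable_toHomotopy [HasBinaryBiproducts A] {K : BoundedComplex A}
    (hK : ∀ f : End K.obj, IsNilpotent f ∨ IsUnit f)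
    (hK' : IsEmpty (Homotopy (𝟙 K.obj) 0)) : Indecomposable (toHomotopy K) := by
  let F := HomotopyCategory.quotient A (ComplexShape.up ℤ)
  refine indecomposable_of_idempotents (fun h => ?_) fun e he => ?_
  · have h0 : F.map (𝟙 K.obj) = 0 := by
      rw [F.map_id]
      exact congrArg (·.hom) ((IsZero.iff_id_eq_zero _).1 h)
    exact hK'.false ((HomotopyCategory.quotient_map_eq_zero_iff _).1 h0).some
  · obtain ⟨f, hf⟩ : ∃ f : K.obj ⟶ K.obj, F.map f = e.hom := F.map_surjective _
    have hidem : F.map f ≫ F.map f = F.map f := by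
      rw [hf]
      exact congrArg (·.hom) he
    rcases eq_zero_or_one_of_isNilpotent_or_isUnit (F.mapEnd K.obj) (F.map_zero _ _) (hK f) hidem
      with h | h
    · left
      ext1
      exact hf.symm.trans h
    · right
      ext1
      exact hf.symm.trans h

theorem finite_end {k : Type w} [Field k] [Linear k A]
    (hA : ∀ M : A, Module.Finite k (M ⟶ M)) {K : CochainComplex A ℤ} (hK : bounded A K) :
    Module.Finite k (End K) := by
  obtain ⟨r, s, h⟩ := hK
  let φ : (K ⟶ K) →ₗ[k] ∀ i : Finset.Icc r s, (K.X i ⟶ K.X i) :=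
    { toFun := fun f i => f.f i
      map_add' := fun _ _ => rfl
      map_smul' := fun _ _ => rfl }
  have hφ : Function.Injective φ := fun f g hfg => by
    ext i
    by_cases hi : i ∈ Finset.Icc r s
    · exact congrFun hfg ⟨i, hi⟩
    · rw [Finset.mem_Icc] at hi
      exact (h i (by lia)).eq_of_src _ _
  exact Module.Finite.of_injective φ hφ

end Bounded

/-! ### Finiteness of `proj Λ` -/

section Algebras

variable (Λ : Type w) [Ring Λ]

instance : (fgProjective Λ).IsStableUnderRetracts where
  of_retract {M N} r hN := by
    have := hN.1
    have := hN.2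
    have h : r.r.hom ∘ₗ r.i.hom = LinearMap.id := congrArg (·.hom) r.retract
    exact ⟨Module.Finite.of_surjective r.r.hom (fun x => ⟨r.i.hom x, LinearMap.congr_fun h x⟩),
      Module.Projective.of_split r.i.hom r.r.hom h⟩

instance : IsIdempotentComplete (ProjCat Λ) := isIdempotentComplete_fullSubcategory _

open scoped ModuleCat in
theorem finite_hom_projCat {k : Type v} [Field k] [Algebra k Λ] [FiniteDimensional k Λ]
    (M : ProjCat Λ) : Module.Finite k (M ⟶ M) := by
  have := M.property.1
  have : Module.Finite k Λᵐᵒᵖ := Module.Finite.equiv (MulOpposite.opLinearEquiv k)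
  have : Module.Finite k M.obj := Module.Finite.trans Λᵐᵒᵖ M.obj
  let φ : (M ⟶ M) →ₗ[k] (M.obj →ₗ[k] M.obj) :=
    { toFun := fun f => f.hom.hom.restrictScalars k
      map_add' := fun _ _ => rfl
      map_smul' := fun _ _ => rfl }
  exact Module.Finite.of_injective φ fun f g h => by
    ext x
    exact LinearMap.congr_fun h x

end Algebras

end FixedSizeComplexes

open FixedSizeComplexes in
theorem corollary3p2 {k : Type v} [Field k] [IsAlgClosed k]
    {Λ : Type w} [Ring Λ] [Algebra k Λ] [FiniteDimensional k Λ]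
    (η : ℕ) (hη : FixedSizeComplexes.strongGlobalDimension Λ = (η : ℕ∞)) (hη_pos : 1 ≤ η)
    (i : ℕ) (hi : 2 ≤ i)
    (X : FixedSizeComplexes.FixedSize (FixedSizeComplexes.ProjCat Λ) (η + i))
    (hX : Indecomposable X) :
    IsZero (X.obj.X 1) ∨ IsZero (X.obj.X ((η + i : ℕ) : ℤ)) := by
  by_contra! hne
  obtain ⟨h1, hn⟩ := hne
  have : IsIdempotentComplete (FixedSize (ProjCat Λ) (η + i)) :=
    isIdempotentComplete_fullSubcategory _
  have hidem (e : X.obj ⟶ X.obj) (he : e ≫ e = e) : e = 0 ∨ e = 𝟙 X.obj :=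
    (eq_zero_or_eq_id_of_indecomposable hX (ObjectProperty.homMk e) (by ext1; exact he)).imp
      (congrArg fun t : X ⟶ X => t.hom) (congrArg fun t : X ⟶ X => t.hom)
  have hcontr : IsEmpty (Homotopy (𝟙 X.obj) 0) :=
    ⟨fun h => hn (isZero_X_of_homotopy_id_zero h hidem
      (fun j hj => X.property j (Or.inl hj)) h1 (by push_cast; lia))⟩
  let K : BoundedComplex (ProjCat Λ) := ⟨X.obj, fixedSize_le_bounded _ _ X.property⟩
  have hfin : Module.Finite k (End K.obj) := finite_end (finite_hom_projCat Λ) K.property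
  have hind : Indecomposable (toHomotopy K) :=
    indecomposable_toHomotopy (isNilpotent_or_isUnit (k := k) hidem) hcontr
  have hlen : HasLength (toHomotopy K) (η + i - 1) :=
    ⟨K, isMinimal_of_idempotents hidem hcontr, ⟨Iso.refl _⟩, 1, (η + i : ℕ), by push_cast; lia,
      h1, hn, fun j hj => X.property j hj, by lia⟩
  have hle : ((η + i - 1 : ℕ) : ℕ∞) ≤ strongGlobalDimension Λ :=
    le_sSup ⟨_, _, hind, hlen, rfl⟩
  rw [hη, Nat.cast_le] at hle
  lia
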